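/- Let $\Sigma$ be a finite alphabet with at least two elements, and let $\mathrm{Pr}$ be the uniform probability measure on $\Sigma^\omega$, i.e. the probability measure on the $\sigma$-algebra generated by the cylinder sets $\mathrm{Cyl}(x)$ (the set of infinite words with prefix $x$), $x \in \Sigma^*$, with $\mathrm{Pr}(\mathrm{Cyl}(a_1\ldots a_n)) = 1/|\Sigma|^n$. Let $\mathcal{U} = (Q,\Sigma,\delta,Q_0,F)$ be a nondeterministic Büchi automaton with finite state set $Q$, transition function $\delta : Q\times\Sigma \to 2^Q$, initial states $Q_0 \subseteq Q$ and final states $F \subseteq Q$. A run for $w = a_1a_2a_3\ldots \in \Sigma^\omega$ is a sequence $q_0q_1q_2\ldots \in Q^\omega$ with $q_0\in Q_0$ and $q_{i+1}\in\delta(q_i,a_{i+1})$ for all $i \ge 0$; it is accepting if $q_i\in F$ for infinitely many $i$. The language $\mathcal{L}_\omega(\mathcal{U})$ is the set of $w \in \Sigma^\omega$ that have an accepting run. Suppose that - $\mathcal{U}$ is unambiguous, i.e. each $w\in\Sigma^\omega$ has at most one accepting run; for $w\in \mathcal{L}_\omega(\mathcal{U})$ let $\mathrm{accrun}(w)$ be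 its unique accepting run; - $\mathcal{U}$ is strongly connected, i.e. for all $p,q\in Q$ there is a finite word $x \in \Sigma^*$ with $q\in\delta(p,x)$, where $\delta$ is extended to finite words in the usual way; - $F\neq\varnothing$. For $\rho \in Q^\omega$ let $\mathrm{inf}(\rho)$ be the set of states that occur infinitely often in $\rho$. Then the sets $\mathcal{L}_\omega(\mathcal{U})$ and $\{w\in\mathcal{L}_\omega(\mathcal{U}) : \mathrm{inf}(\mathrm{accrun}(w)) = Q\}$ are measurable and $$\mathrm{Pr}\bigl\{w\in\mathcal{L}_\omega(\mathcal{U}) : \mathrm{inf}(\mathrm{accrun}(w)) = Q\bigr\} = \mathrm{Pr}\bigl(\mathcal{L}_\omega(\mathcal{U})\bigr).$$ -/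

import Mathlib

open MeasureTheory

/-- A nondeterministic Büchi automaton `(Q, Σ, δ, Q₀, F)` with alphabet `A` (for `Σ`) and state
type `Q`. Finiteness of `A` and `Q` is imposed by type classes where the automaton is used. -/
structure NBA (A Q : Type*) where
  /-- the transition function `δ : Q × Σ → 2^Q` -/
  delta : Q → A → Set Q
  /-- the set `Q₀` of initial states -/
  init : Set Q
  /-- the set `F` of accepting (final) states -/
  final : Set Q

namespace NBA

variable {A Q : Type*}

/-- The extension of the transition function to sets of states and finite words. -/
def deltaStar (U : NBA A Q) : Set Q → List A → Set Q
  | R, [] => R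
  | R, a :: x => U.deltaStar (⋃ q ∈ R, U.delta q a) x

/-- Every state is reachable from every state by some finite word. -/
def StronglyConnected (U : NBA A Q) : Prop :=
  ∀ p q : Q, ∃ x : List A, q ∈ U.deltaStar {p} x

/-- `ρ = q₀ q₁ q₂ …` is a run for the infinite word `w`; the letters of `w` are
`w 0, w 1, w 2, …`, and `w i` is the letter read between `ρ i` and `ρ (i + 1)`. -/
def IsRun (U : NBA A Q) (w : ℕ → A) (ρ : ℕ → Q) : Prop :=
  ρ 0 ∈ U.init ∧ ∀ i, ρ (i + 1) ∈ U.delta (ρ i) (w i)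

/-- A run is accepting if it is in `F` at infinitely many positions. -/
def IsAcceptingRun (U : NBA A Q) (w : ℕ → A) (ρ : ℕ → Q) : Prop :=
  U.IsRun w ρ ∧ {i : ℕ | ρ i ∈ U.final}.Infinite

/-- The language of the infinite words that have at least one accepting run. -/
def language (U : NBA A Q) : Set (ℕ → A) :=
  {w | ∃ ρ, U.IsAcceptingRun w ρ}

/-- Each infinite word has at most one accepting run. -/
def Unambiguous (U : NBA A Q) : Prop :=
  ∀ (w : ℕ → A) (ρ ρ' : ℕ → Q), U.IsAcceptingRun w ρ → U.IsAcceptingRun w ρ' → ρ = ρ'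

/-- The accepting run of an accepted word; in an unambiguous automaton it is the unique one
(see `accRun_spec` and `eq_accRun`). -/
noncomputable def accRun (U : NBA A Q) (w : ℕ → A) (hw : w ∈ U.language) : ℕ → Q :=
  Classical.choose hw

theorem accRun_spec (U : NBA A Q) (w : ℕ → A) (hw : w ∈ U.language) :
    U.IsAcceptingRun w (U.accRun w hw) :=
  Classical.choose_spec hw

theorem eq_accRun (U : NBA A Q) (hU : U.Unambiguous) (w : ℕ → A) (hw : w ∈ U.language)
    (ρ : ℕ → Q) (hρ : U.IsAcceptingRun w ρ) : ρ = U.accRun w hw :=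
  hU w _ _ hρ (U.accRun_spec w hw)

end NBA

/-- The set of states that appear infinitely often in a sequence of states. -/
def infStates {Q : Type*} (ρ : ℕ → Q) : Set Q :=
  {q | {i : ℕ | ρ i = q}.Infinite}

/-- The uniform probability measure on infinite words: the letters are independent and uniformly
distributed. The `σ`-algebra on `ℕ → A` is the product one, which is the one generated by the
cylinder sets when all subsets of the finite alphabet `A` are measurable. -/
noncomputable def wordMeasure (A : Type*) [Fintype A] [Nonempty A] [MeasurableSpace A] :
    Measure (ℕ → A) :=
  Measure.infinitePi fun _ : ℕ => (PMF.uniformOfFintype A).toMeasure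

/-- The cylinder set of the finite word `x`. -/
def cylinderSet {A : Type*} (x : List A) : Set (ℕ → A) :=
  {w | ∀ i : Fin x.length, w i = x.get i}

/-- The cylinder set of a finite word of length `n` has measure `1 / |A| ^ n`. -/
theorem wordMeasure_cylinderSet {A : Type*} [Fintype A] [Nonempty A] [MeasurableSpace A]
    [DiscreteMeasurableSpace A] (x : List A) :
    wordMeasure A (cylinderSet x) = 1 / (Fintype.card A : ENNReal) ^ x.length := by
  classical
  have hx : cylinderSet x = Set.pi (Finset.range x.length : Set ℕ)
      (fun i => if h : i < x.length then {x.get ⟨i, h⟩} else Set.univ) := by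
    ext w
    simp only [cylinderSet, Set.mem_ofPred_eq, Set.mem_pi, Finset.coe_range, Set.mem_Iio]
    constructor
    · intro h i hi
      simpa [hi] using h ⟨i, hi⟩
    · intro h i
      simpa using h i i.2
  rw [hx, wordMeasure, Measure.infinitePi_pi _ (fun i _ => MeasurableSet.of_discrete)]
  have : ∀ i ∈ Finset.range x.length, (PMF.uniformOfFintype A).toMeasure
      (if h : i < x.length then {x.get ⟨i, h⟩} else Set.univ)
        = (Fintype.card A : ENNReal)⁻¹ := by
    intro i hi
    have hi' : i < x.length := Finset.mem_range.1 hi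
    rw [dif_pos hi', PMF.toMeasure_apply_singleton _ _ (MeasurableSet.of_discrete)]
    simp
  rw [Finset.prod_congr rfl this]
  simp [ENNReal.inv_pow]

/-!
By unambiguity, the vector `e` of the acceptance probabilities from the single states satisfies
`M *ᵥ e = e` for the transition matrix `M`: the accepted words are split disjointly by the second
state of the accepting run. The vector `f` of the probabilities of accepting along a run that never
visits `q` satisfies `f ≤ M *ᵥ f`, `f ≤ e` and `f q = 0`. By a maximum principle for irreducible
nonnegative matrices, `f = 0`: the smallest multiple of `e` above `f` touches `f` somewhere, hence
coincides with `f` everywhere, and it vanishes at `q`. A run that visits `q` only finitely often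
has a suffix that never visits `q`, so shift invariance of the measure excludes such accepting runs
almost surely.
-/

open Relation Filter

open scoped Matrix

section MaximumPrinciple

variable {n R : Type*} [Fintype n]

theorem eq_of_le_mulVec_of_mulVec_le [Semiring R] [LinearOrder R] [IsStrictOrderedRing R]
    {M : Matrix n n R} {f g : n → R} (hM : ∀ i j, 0 ≤ M i j)
    (hconn : ∀ i j, ReflTransGen (fun i j => 0 < M i j) i j) (hfg : f ≤ g)
    (hf : f ≤ M *ᵥ f) (hg : M *ᵥ g ≤ g) {i : n} (hi : f i = g i) : f = g := by
  funext j
  induction hconn i j with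
  | refl => exact hi
  | @tail k l _ hkl hk =>
    have hle : ∀ m ∈ Finset.univ, M k m * f m ≤ M k m * g m := fun m _ =>
      mul_le_mul_of_nonneg_left (hfg m) (hM k m)
    have hsum : ∑ m, M k m * f m = ∑ m, M k m * g m :=
      le_antisymm (Finset.sum_le_sum hle) ((hg k).trans (hk.ge.trans (hf k)))
    exact (mul_left_cancel_iff_of_pos hkl).1
      ((Finset.sum_eq_sum_iff_of_le hle).1 hsum l (Finset.mem_univ l))

theorem eq_zero_of_le_mulVec_of_mulVec_le [Semifield R] [LinearOrder R] [IsStrictOrderedRing R]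
    {M : Matrix n n R} {f g : n → R} (hM : ∀ i j, 0 ≤ M i j)
    (hconn : ∀ i j, ReflTransGen (fun i j => 0 < M i j) i j) (hf₀ : 0 ≤ f) (hfg : f ≤ g)
    (hf : f ≤ M *ᵥ f) (hg : M *ᵥ g ≤ g) {i : n} (hi : f i = 0) : f = 0 := by
  have hg₀ : 0 ≤ g := hf₀.trans hfg
  by_cases hzero : ∃ j, g j = 0
  · obtain ⟨j, hj⟩ := hzero
    have hg_zero : 0 = g :=
      eq_of_le_mulVec_of_mulVec_le hM hconn hg₀ (Matrix.mulVec_zero M).ge hg hj.symm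
    exact le_antisymm (hfg.trans hg_zero.ge) hf₀
  · have hg_pos : ∀ j, 0 < g j := fun j => (hg₀ j).lt_of_ne' fun hj => hzero ⟨j, hj⟩
    have : Nonempty n := ⟨i⟩
    obtain ⟨m, hm⟩ := Finite.exists_max fun j => f j / g j
    set c := f m / g m
    have hc : 0 ≤ c := div_nonneg (hf₀ m) (hg₀ m)
    have hfcg : f = c • g := by
      refine eq_of_le_mulVec_of_mulVec_le hM hconn (fun j => (div_le_iff₀ (hg_pos j)).1 (hm j)) hf
        ?_ (div_mul_cancel₀ (f m) (hg_pos m).ne').symm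
      rw [Matrix.mulVec_smul]
      exact smul_le_smul_of_nonneg_left hg hc
    have hc_zero : c = 0 := by
      have hcg : c * g i = 0 := (congrFun hfcg i).symm.trans hi
      exact (mul_eq_zero.1 hcg).resolve_right (hg_pos i).ne'
    rw [hfcg, hc_zero, zero_smul]

end MaximumPrinciple

section Sequences

variable {X : Type*}

/-- The sequence `w` without its first `n` terms; it is applied both to words and to runs. -/
def dropFirst (n : ℕ) (w : ℕ → X) : ℕ → X := fun i => w (i + n)

/-- The sequence `x, w 0, w 1, …`; it extends words and runs to the left by one position. -/
def prepend (x : X) (w : ℕ → X) : ℕ → X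
  | 0 => x
  | i + 1 => w i

theorem prepend_injective (x : X) : Function.Injective (prepend x) := fun _ _ h =>
  funext fun i => congrFun h (i + 1)

theorem infinite_setOf_dropFirst_mem {n : ℕ} {w : ℕ → X} {S : Set X} :
    {i | dropFirst n w i ∈ S}.Infinite ↔ {i | w i ∈ S}.Infinite := by
  conv_rhs => rw [← Nat.frequently_atTop_iff_infinite, ← map_add_atTop_eq_nat n, frequently_map]
  exact Nat.frequently_atTop_iff_infinite.symm

theorem measurableSet_setOf_infinite [MeasurableSpace X] {s : ℕ → Set X}
    (hs : ∀ i, MeasurableSet (s i)) : MeasurableSet {x | {i | x ∈ s i}.Infinite} := by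
  rw [← cofinite.limsup_set_eq, Nat.cofinite_eq_atTop]
  exact .measurableSet_limsup hs

end Sequences

section IIDMeasure

variable {A : Type*} [MeasurableSpace A] (P : Measure A) [IsProbabilityMeasure P]

/-- The law of an infinite word whose letters are independent with common law `P`; the uniform
measure `wordMeasure` is the case of the uniform law `P`. -/
noncomputable abbrev iidMeasure : Measure (ℕ → A) := Measure.infinitePi fun _ : ℕ => P

theorem measurePreserving_dropFirst (n : ℕ) :
    MeasurePreserving (dropFirst n) (iidMeasure P) (iidMeasure P) where
  measurable := measurable_pi_lambda _ fun i => measurable_pi_apply (i + n)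
  map_eq := Measure.map_infinitePi_infinitePi_of_inj (add_left_injective n)

theorem indepFun_eval_zero_dropFirst_one :
    ProbabilityTheory.IndepFun (fun w : ℕ → A => w 0) (dropFirst 1) (iidMeasure P) := by
  have hletters : ProbabilityTheory.iIndepFun (fun i (w : ℕ → A) => w i) (iidMeasure P) :=
    ProbabilityTheory.iIndepFun_infinitePi (X := fun _ => id) fun _ => measurable_id
  have hsplit := ProbabilityTheory.indep_iSup_of_disjoint
    (fun i => (measurable_pi_apply i).comap_le) hletters.iIndep
    (disjoint_compl_right (a := ({0} : Set ℕ)))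
  rw [ProbabilityTheory.IndepFun_iff_Indep]
  refine ProbabilityTheory.indep_of_indep_of_le_left
    (ProbabilityTheory.indep_of_indep_of_le_right hsplit ?_) ?_
  · refine Measurable.comap_le ?_
    refine @measurable_pi_lambda _ _ _ (_) _ _ fun i => ?_
    exact measurable_iff_comap_le.2 (le_iSup₂_of_le (i + 1) (Nat.succ_ne_zero i) le_rfl)
  · exact le_iSup₂_of_le 0 rfl le_rfl

theorem iidMeasure_real_head_inter_tail {D : Set A} {S : Set (ℕ → A)} (hD : MeasurableSet D)
    (hS : MeasurableSet S) :
    (iidMeasure P).real {w | w 0 ∈ D ∧ dropFirst 1 w ∈ S} =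
      P.real D * (iidMeasure P).real S := by
  have hindep := (indepFun_eval_zero_dropFirst_one P).measure_inter_preimage_eq_mul D S hD hS
  have hhead := (measurePreserving_eval_infinitePi (fun _ : ℕ => P) 0).measure_preimage
    hD.nullMeasurableSet
  have htail := (measurePreserving_dropFirst P 1).measure_preimage hS.nullMeasurableSet
  rw [measureReal_def, measureReal_def, measureReal_def, ← ENNReal.toReal_mul, ← hhead, ← htail]
  exact congrArg ENNReal.toReal hindep

end IIDMeasure

namespace NBA

variable {A Q : Type*} {U : NBA A Q}

section Reachability

theorem exists_reflTransGen_of_mem_deltaStar {x : List A} {R : Set Q} {q : Q}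
    (hq : q ∈ U.deltaStar R x) :
    ∃ p ∈ R, ReflTransGen (fun p r => ∃ a, r ∈ U.delta p a) p q := by
  induction x generalizing R with
  | nil => exact ⟨q, hq, .refl⟩
  | cons a x ih =>
    obtain ⟨r, hr, hrq⟩ := ih hq
    obtain ⟨p, hp, hpr⟩ := Set.mem_iUnion₂.1 hr
    exact ⟨p, hp, .head ⟨a, hpr⟩ hrq⟩

theorem StronglyConnected.reflTransGen (hconn : U.StronglyConnected) (p q : Q) :
    ReflTransGen (fun p r => ∃ a, r ∈ U.delta p a) p q := by
  obtain ⟨x, hx⟩ := hconn p q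
  obtain ⟨_, rfl, hpq⟩ := exists_reflTransGen_of_mem_deltaStar hx
  exact hpq

end Reachability

section StartAt

/-- The automaton `U` with `p` as its only initial state. -/
def startAt (U : NBA A Q) (p : Q) : NBA A Q :=
  { U with init := {p} }

theorem IsAcceptingRun.startAt_dropFirst {w : ℕ → A} {ρ : ℕ → Q} (h : U.IsAcceptingRun w ρ)
    (n : ℕ) : (U.startAt (ρ n)).IsAcceptingRun (dropFirst n w) (dropFirst n ρ) := by
  refine ⟨⟨congrArg ρ (zero_add n), fun i => ?_⟩, infinite_setOf_dropFirst_mem.2 h.2⟩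
  have hstep : ρ (i + n + 1) ∈ U.delta (ρ (i + n)) (w (i + n)) := h.1.2 (i + n)
  rwa [add_right_comm] at hstep

theorem IsAcceptingRun.prepend {w : ℕ → A} {ρ : ℕ → Q} {p q : Q} (hq : q ∈ U.delta p (w 0))
    (h : (U.startAt q).IsAcceptingRun (dropFirst 1 w) ρ) :
    (U.startAt p).IsAcceptingRun w (prepend p ρ) := by
  obtain ⟨⟨h0 : ρ 0 = q, hstep⟩, hfinal⟩ := h
  refine ⟨⟨rfl, fun i => ?_⟩, infinite_setOf_dropFirst_mem (n := 1).1 hfinal⟩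
  cases i with
  | zero => exact Set.mem_of_eq_of_mem h0 hq
  | succ i => exact hstep i

theorem Unambiguous.startAt_of_mem_init (hU : U.Unambiguous) {p : Q} (hp : p ∈ U.init) :
    (U.startAt p).Unambiguous := by
  have hrun {w ρ} (h : (U.startAt p).IsAcceptingRun w ρ) : U.IsAcceptingRun w ρ :=
    ⟨⟨Set.mem_of_eq_of_mem h.1.1 hp, h.1.2⟩, h.2⟩
  exact fun w ρ ρ' h h' => hU w ρ ρ' (hrun h) (hrun h')

theorem Unambiguous.startAt_of_mem_delta {p q : Q} {a : A} (hU : (U.startAt p).Unambiguous)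
    (hq : q ∈ U.delta p a) : (U.startAt q).Unambiguous := fun w _ _ h h' =>
  prepend_injective p <| hU (_root_.prepend a w) _ _ (h.prepend hq) (h'.prepend hq)

theorem Unambiguous.startAt (hU : U.Unambiguous) (hconn : U.StronglyConnected) {p : Q}
    (hp : p ∈ U.init) (q : Q) : (U.startAt q).Unambiguous := by
  induction hconn.reflTransGen p q with
  | refl => exact hU.startAt_of_mem_init hp
  | tail _ hstep ih => exact ih.startAt_of_mem_delta hstep.choose_spec

theorem language_startAt (p : Q) :
    (U.startAt p).language =
      ⋃ q, {w | w 0 ∈ {a | q ∈ U.delta p a} ∧ dropFirst 1 w ∈ (U.startAt q).language} := by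
  ext w
  simp only [Set.mem_iUnion]
  constructor
  · rintro ⟨ρ, hρ⟩
    have h0 : ρ 0 = p := hρ.1.1
    exact ⟨ρ 1, h0 ▸ hρ.1.2 0, dropFirst 1 ρ, hρ.startAt_dropFirst 1⟩
  · rintro ⟨q, hq, ρ, hρ⟩
    exact ⟨_, hρ.prepend hq⟩

theorem Unambiguous.pairwise_disjoint_first_step {p : Q} (hU : (U.startAt p).Unambiguous) :
    Pairwise fun q r => Disjoint
      {w | w 0 ∈ {a | q ∈ U.delta p a} ∧ dropFirst 1 w ∈ (U.startAt q).language}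
      {w | w 0 ∈ {a | r ∈ U.delta p a} ∧ dropFirst 1 w ∈ (U.startAt r).language} := by
  refine fun q r hqr => Set.disjoint_left.2 ?_
  rintro w ⟨hq, ρ, hρ⟩ ⟨hr, ρ', hρ'⟩
  have hρρ' : ρ = ρ' := prepend_injective p (hU w _ _ (hρ.prepend hq) (hρ'.prepend hr))
  exact hqr (hρ.1.1.symm.trans ((congrFun hρρ' 0).trans hρ'.1.1))

end StartAt

section Avoid

/-- The automaton `U` without the transitions that leave `q`. A run that visits `q` gets stuck
there, so the infinite runs are exactly the runs of `U` that never visit `q`. -/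
def avoid (U : NBA A Q) (q : Q) : NBA A Q :=
  { U with delta := fun p a => {r ∈ U.delta p a | p ≠ q} }

theorem isAcceptingRun_avoid {q : Q} {w : ℕ → A} {ρ : ℕ → Q} :
    (U.avoid q).IsAcceptingRun w ρ ↔ U.IsAcceptingRun w ρ ∧ ∀ i, ρ i ≠ q := by
  have hrun : (U.avoid q).IsRun w ρ ↔ U.IsRun w ρ ∧ ∀ i, ρ i ≠ q :=
    (and_congr_right fun _ => forall_and).trans and_assoc.symm
  exact (and_congr_left fun _ => hrun).trans and_right_comm

theorem Unambiguous.avoid (hU : U.Unambiguous) (q : Q) : (U.avoid q).Unambiguous :=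
  fun w ρ ρ' h h' => hU w ρ ρ' (isAcceptingRun_avoid.1 h).1 (isAcceptingRun_avoid.1 h').1

theorem language_avoid_subset (q : Q) : (U.avoid q).language ⊆ U.language := fun _ ⟨ρ, hρ⟩ =>
  ⟨ρ, (isAcceptingRun_avoid.1 hρ).1⟩

theorem language_startAt_avoid_self (q : Q) : ((U.startAt q).avoid q).language = ∅ :=
  Set.eq_empty_of_forall_notMem fun _ ⟨_, hρ⟩ => (isAcceptingRun_avoid.1 hρ).2 0 hρ.1.1

end Avoid

section Measurability

variable [Countable A] [MeasurableSpace A] [DiscreteMeasurableSpace A] [Countable Q]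

theorem measurableSet_isAcceptingRun [MeasurableSpace Q] [DiscreteMeasurableSpace Q]
    (U : NBA A Q) : MeasurableSet {x : (ℕ → A) × (ℕ → Q) | U.IsAcceptingRun x.1 x.2} := by
  have hinit : MeasurableSet {x : (ℕ → A) × (ℕ → Q) | x.2 0 ∈ U.init} :=
    ((measurable_pi_apply 0).comp measurable_snd) (.of_discrete (s := U.init))
  have hstep : Measurable fun x : (ℕ → A) × (ℕ → Q) =>
      ∀ i, x.2 (i + 1) ∈ U.delta (x.2 i) (x.1 i) := .forall fun i => by
    have htransition : Measurable fun x : (ℕ → A) × (ℕ → Q) => (x.2 (i + 1), x.2 i, x.1 i) := by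
      fun_prop
    exact (Measurable.of_discrete
      (f := fun y : Q × Q × A => y.1 ∈ U.delta y.2.1 y.2.2)).comp htransition
  have hfinal : MeasurableSet {x : (ℕ → A) × (ℕ → Q) | {i | x.2 i ∈ U.final}.Infinite} :=
    measurableSet_setOf_infinite fun i =>
      ((measurable_pi_apply i).comp measurable_snd) (.of_discrete (s := U.final))
  exact (hinit.inter hstep.setOf).inter hfinal

theorem Unambiguous.measurableSet_exists_isAcceptingRun_mem [MeasurableSpace Q]
    [DiscreteMeasurableSpace Q] (hU : U.Unambiguous) {T : Set (ℕ → Q)} (hT : MeasurableSet T) :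
    MeasurableSet {w | ∃ ρ, U.IsAcceptingRun w ρ ∧ ρ ∈ T} := by
  -- By unambiguity the projection to words is injective, so the Lusin-Souslin theorem applies.
  have hinj : Set.InjOn Prod.fst
      ({x : (ℕ → A) × (ℕ → Q) | U.IsAcceptingRun x.1 x.2} ∩ Prod.snd ⁻¹' T) := by
    rintro ⟨w, ρ⟩ ⟨h, -⟩ ⟨w', ρ'⟩ ⟨h', -⟩ (rfl : w = w')
    exact Prod.ext rfl (hU w ρ ρ' h h')
  convert (U.measurableSet_isAcceptingRun.inter (measurable_snd hT)).image_of_measurable_injOn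
    measurable_fst hinj
  ext w
  simp

theorem Unambiguous.measurableSet_language (hU : U.Unambiguous) : MeasurableSet U.language := by
  let : MeasurableSpace Q := ⊤
  have : DiscreteMeasurableSpace Q := ⟨fun _ => trivial⟩
  simpa [language] using hU.measurableSet_exists_isAcceptingRun_mem MeasurableSet.univ

theorem Unambiguous.measurableSet_infStates_accRun_eq_univ (hU : U.Unambiguous) :
    MeasurableSet {w | ∃ hw : w ∈ U.language, infStates (U.accRun w hw) = Set.univ} := by
  let : MeasurableSpace Q := ⊤
  have : DiscreteMeasurableSpace Q := ⟨fun _ => trivial⟩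
  have hT : MeasurableSet {ρ : ℕ → Q | infStates ρ = Set.univ} := by
    simp only [Set.eq_univ_iff_forall]
    exact (Measurable.forall fun q => measurableSet_setOfPred.1 <|
      measurableSet_setOf_infinite fun i =>
        ((measurable_pi_apply i).eq_const q).setOf).setOf
  convert hU.measurableSet_exists_isAcceptingRun_mem hT
  constructor
  · rintro ⟨hw, hinf⟩
    exact ⟨_, U.accRun_spec _ hw, hinf⟩
  · rintro ⟨ρ, hρ, hinf⟩
    exact ⟨⟨ρ, hρ⟩, U.eq_accRun hU _ ⟨ρ, hρ⟩ ρ hρ ▸ hinf⟩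

end Measurability

section TransitionMatrix

variable [MeasurableSpace A] (P : Measure A)

/-- The matrix whose `(p, q)` entry is the probability that a random letter with law `P` allows
the transition from `p` to `q`. It need not be substochastic, since one letter may allow several
transitions. -/
noncomputable def transitionMatrix (U : NBA A Q) : Matrix Q Q ℝ :=
  fun p q => P.real {a | q ∈ U.delta p a}

/-- The probability that a word with independent letters of law `P` is accepted from `p`. -/
noncomputable def acceptProb (U : NBA A Q) [IsProbabilityMeasure P] (p : Q) : ℝ :=
  (iidMeasure P).real (U.startAt p).language

theorem StronglyConnected.reflTransGen_transitionMatrix [IsFiniteMeasure P]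
    (hconn : U.StronglyConnected) (hP : ∀ a, P {a} ≠ 0) (p q : Q) :
    ReflTransGen (fun p q => 0 < U.transitionMatrix P p q) p q := by
  refine ReflTransGen.mono (fun _ _ ⟨a, ha⟩ => ?_) p q (hconn.reflTransGen p q)
  exact (ENNReal.toReal_pos (hP a) (measure_ne_top P {a})).trans_le
    (measureReal_mono (Set.singleton_subset_iff.2 ha))

theorem transitionMatrix_avoid_le [IsFiniteMeasure P] (p q r : Q) :
    (U.avoid q).transitionMatrix P p r ≤ U.transitionMatrix P p r :=
  measureReal_mono fun _ ha => ha.1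

theorem transitionMatrix_mulVec_acceptProb [Countable A] [DiscreteMeasurableSpace A] [Fintype Q]
    [IsProbabilityMeasure P] (hU : ∀ p, (U.startAt p).Unambiguous) :
    U.transitionMatrix P *ᵥ U.acceptProb P = U.acceptProb P := by
  funext p
  have hmeas (q : Q) : MeasurableSet
      {w | w 0 ∈ {a | q ∈ U.delta p a} ∧ dropFirst 1 w ∈ (U.startAt q).language} :=
    (measurable_pi_apply (X := fun _ => A) 0 (.of_discrete (s := {a | q ∈ U.delta p a}))).inter
      ((measurePreserving_dropFirst P 1).measurable (hU q).measurableSet_language)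
  rw [acceptProb, language_startAt,
    measureReal_iUnion_fintype (hU p).pairwise_disjoint_first_step hmeas]
  exact Finset.sum_congr rfl fun q _ => (iidMeasure_real_head_inter_tail P .of_discrete
    (hU q).measurableSet_language).symm

end TransitionMatrix

section AlmostSure

variable [Countable A] [MeasurableSpace A] [DiscreteMeasurableSpace A] [Finite Q]
  {P : Measure A} [IsProbabilityMeasure P]

theorem acceptProb_avoid_eq_zero (hP : ∀ a, P {a} ≠ 0) (hconn : U.StronglyConnected)
    (hU : ∀ p, (U.startAt p).Unambiguous) (q : Q) : (U.avoid q).acceptProb P = 0 := by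
  have := Fintype.ofFinite Q
  have hnonneg : 0 ≤ (U.avoid q).acceptProb P := fun _ => measureReal_nonneg
  refine eq_zero_of_le_mulVec_of_mulVec_le (fun _ _ => measureReal_nonneg)
    (hconn.reflTransGen_transitionMatrix P hP) hnonneg
    (fun p => measureReal_mono (language_avoid_subset (U := U.startAt p) q)) ?_
    (transitionMatrix_mulVec_acceptProb P hU).le (i := q) ?_
  · calc (U.avoid q).acceptProb P
        = (U.avoid q).transitionMatrix P *ᵥ (U.avoid q).acceptProb P :=
          (transitionMatrix_mulVec_acceptProb (U := U.avoid q) P fun p => (hU p).avoid q).symm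
      _ ≤ U.transitionMatrix P *ᵥ (U.avoid q).acceptProb P := fun p =>
          Finset.sum_le_sum fun r _ =>
            mul_le_mul_of_nonneg_right (transitionMatrix_avoid_le P p q r) (hnonneg r)
  · exact (congrArg (iidMeasure P).real (U.language_startAt_avoid_self q)).trans measureReal_empty

theorem ae_forall_isAcceptingRun_infStates_eq_univ (hP : ∀ a, P {a} ≠ 0) (hU : U.Unambiguous)
    (hconn : U.StronglyConnected) :
    ∀ᵐ w ∂iidMeasure P, ∀ ρ, U.IsAcceptingRun w ρ → infStates ρ = Set.univ := by
  rcases U.init.eq_empty_or_nonempty with hinit | ⟨p₀, hp₀⟩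
  · exact .of_forall fun w ρ hρ => absurd hρ.1.1 (hinit ▸ Set.notMem_empty (ρ 0))
  have := Fintype.ofFinite Q
  have hnull (p q : Q) : ∀ᵐ w ∂iidMeasure P, w ∉ ((U.avoid q).startAt p).language :=
    measure_eq_zero_iff_ae_notMem.1 <| (measureReal_eq_zero_iff).1 <|
      congrFun (acceptProb_avoid_eq_zero hP hconn (hU.startAt hconn hp₀) q) p
  have hnull_suffix : ∀ᵐ w ∂iidMeasure P, ∀ (n : ℕ) (p q : Q),
      dropFirst n w ∉ ((U.avoid q).startAt p).language :=
    ae_all_iff.2 fun n => ae_all_iff.2 fun p => ae_all_iff.2 fun q =>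
      (measurePreserving_dropFirst P n).quasiMeasurePreserving.ae (hnull p q)
  filter_upwards [hnull_suffix] with w hw ρ hρ
  refine Set.eq_univ_of_forall fun q => Nat.frequently_atTop_iff_infinite.1 fun hq => ?_
  obtain ⟨n, hn⟩ := eventually_atTop.1 hq
  exact hw n (ρ n) q ⟨dropFirst n ρ, isAcceptingRun_avoid.2
    ⟨hρ.startAt_dropFirst n, fun i => hn (i + n) (Nat.le_add_left n i)⟩⟩

end AlmostSure

end NBA

theorem mainTheorem10_general {A Q : Type*} [Countable A] [MeasurableSpace A]
    [DiscreteMeasurableSpace A] [Finite Q] (P : Measure A) [IsProbabilityMeasure P]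
    (hP : ∀ a, P {a} ≠ 0) (U : NBA A Q) (hunamb : U.Unambiguous) (hconn : U.StronglyConnected) :
    MeasurableSet U.language ∧
    MeasurableSet {w : ℕ → A | ∃ hw : w ∈ U.language,
      infStates (U.accRun w hw) = Set.univ} ∧
    iidMeasure P {w : ℕ → A | ∃ hw : w ∈ U.language,
      infStates (U.accRun w hw) = Set.univ} = iidMeasure P U.language := by
  refine ⟨hunamb.measurableSet_language, hunamb.measurableSet_infStates_accRun_eq_univ,
    measure_congr (eventuallyEq_set.2 ?_)⟩
  filter_upwards [NBA.ae_forall_isAcceptingRun_infStates_eq_univ hP hunamb hconn] with w hw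
  exact ⟨fun ⟨hlang, _⟩ => hlang, fun hlang => ⟨hlang, hw _ (U.accRun_spec w hlang)⟩⟩

theorem mainTheorem10 {A Q : Type*} [Fintype A] [Nontrivial A] [MeasurableSpace A]
    [DiscreteMeasurableSpace A] [Finite Q] (U : NBA A Q) (hunamb : U.Unambiguous)
    (hconn : U.StronglyConnected) (hfinal : U.final.Nonempty) :
    MeasurableSet U.language ∧
    MeasurableSet {w : ℕ → A | ∃ hw : w ∈ U.language,
      infStates (U.accRun w hw) = Set.univ} ∧
    wordMeasure A {w : ℕ → A | ∃ hw : w ∈ U.language,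
      infStates (U.accRun w hw) = Set.univ} = wordMeasure A U.language := by
  exact mainTheorem10_general (PMF.uniformOfFintype A).toMeasure
    (fun a => by simp) U hunamb hconn
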